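/- A Polish metric space is a complete separable metric space, and products of metric spaces carry the sum metric $d((x,k),(x',k'))=d(x,x')+d(k,k')$. The Urysohn space $\mathbb{U}$ is the complete separable metric space with the property that for every finite metric space $M$, every (possibly empty) subset $S\subseteq M$ and every isometric embedding $f:S\to\mathbb{U}$ there is an isometric embedding $g:M\to\mathbb{U}$ extending $f$; such a space exists, and the following holds for each such space. **Theorem 2.3.** For every compact metric space $K$ there is a closed subset $C\subseteq\mathbb{U}\times K$ with the following two properties. 1. (Universality) For every Polish metric space $X$ and every closed subset $D\subseteq X\times K$ there is an isometric embedding $\iota:X\to\mathbb{U}$ such that for all $x\in X$ and $k\in K$ we have $(x,k)\in D$ if and only if $(\iota(x),k)\in C$; moreover, if $D\neq\emptyset$, then $\iota$ can be chosen so that in addition $\operatorname{dist}((x,k),D)=\operatorname{dist}((\iota(x),k),C)$ for all $x\in X$ and $k\in K$. 2. (Ultrahomogeneity) For every finite subset $A\subseteq\mathbb{U}$ and every isometric embedding $\varphi:A\to\mathbb{U}$ such that $\operatorname{dist}((\varphi(a),k),C)=\operatorname{dist}((a,k),C)$ for all $a\in A$ and $k\in K$, there is an isometry $\Phi$ of $\mathbb{U}$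 onto $\mathbb{U}$ that extends $\varphi$ and satisfies $(x,k)\in C$ if and only if $(\Phi(x),k)\in C$, for all $x\in\mathbb{U}$ and $k\in K$. -/

import Mathlib

universe u v w

/-- `U` is (a copy of) the Urysohn universal metric space: a complete separable metric space in
which every abstract finite metric extension `M` of a finite subspace is realized.
Here `S ⊆ M` is the subspace that already sits in `U`, through the isometric embedding `f`;
`S` may be empty.  Every finite metric space has an isometric copy in `Type`. -/
structure IsUrysohnSpace (U : Type u) [MetricSpace U] : Prop where
  complete : CompleteSpace U
  separable : TopologicalSpace.SeparableSpace U
  extension : ∀ (M : Type) [MetricSpace M] [Finite M] (S : Set M) (f : S → U), Isometry f →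
    ∃ g : M → U, Isometry g ∧ ∀ s : S, g s = f s

/-- The product `X × K` with the sum metric `d((x, k), (x', k')) = d(x, x') + d(k, k')`. -/
abbrev SumProd (X : Type u) (K : Type v) : Type (max u v) := WithLp 1 (X × K)

/-- The point `(x, k)` of the product with the sum metric. -/
abbrev SumProd.mk {X : Type u} {K : Type v} (x : X) (k : K) : SumProd X K :=
  WithLp.toLp 1 (x, k)

/-- `C ⊆ U × K` is universal: each closed `D ⊆ X × K`, with `X` a Polish metric space, is
induced from `C` along an isometric embedding `ι : X → U`, and for nonempty `D` this embedding
also carries the distance function of `D` to the distance function of `C`.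
(If `D` is empty, it has no real-valued distance function.) -/
def IsUniversalClosedSubset {U : Type u} {K : Type v} [MetricSpace U] [MetricSpace K]
    (C : Set (SumProd U K)) : Prop :=
  ∀ (X : Type w) [MetricSpace X] [CompleteSpace X] [TopologicalSpace.SeparableSpace X]
    (D : Set (SumProd X K)), IsClosed D →
    ∃ ι : X → U, Isometry ι ∧
      (∀ (x : X) (k : K), SumProd.mk x k ∈ D ↔ SumProd.mk (ι x) k ∈ C) ∧
      (D.Nonempty → ∀ (x : X) (k : K),
        Metric.infDist (SumProd.mk x k) D = Metric.infDist (SumProd.mk (ι x) k) C)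

/-- `C ⊆ U × K` is ultrahomogeneous: every isomorphism between finite substructures of `(U, C)`,
i.e. every isometric map `φ` from a finite set `A ⊆ U` into `U` which preserves the distances
to `C`, extends to an automorphism of `(U, C)`, i.e. to an isometry `Φ` of `U` onto `U` such that
`Φ × id` maps `C` onto `C`. -/
def IsUltrahomogeneousSubset {U : Type u} {K : Type v} [MetricSpace U] [MetricSpace K]
    (C : Set (SumProd U K)) : Prop :=
  ∀ (A : Set U) (φ : A → U), A.Finite → Isometry φ →
    (∀ (a : A) (k : K),
      Metric.infDist (SumProd.mk (φ a) k) C = Metric.infDist (SumProd.mk (a : U) k) C) →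
    ∃ Φ : U ≃ᵢ U, (∀ a : A, Φ a = φ a) ∧
      ∀ (x : U) (k : K), SumProd.mk x k ∈ C ↔ SumProd.mk (Φ x) k ∈ C

open Filter Topology

/-! A nonempty closed `C` is the zero set of the functions `k ↦ dist ((x, k), C)`, and these form a
1-Lipschitz map `F` from `U` to the complete separable space `DistMap K`. It suffices to find a
generic `F`: one that realizes every one-point extension of finitely many points, with every
compatible value. The zero set of such an `F` has distance function `F` (`infDist_zeroLocus`), so
universality is the forth argument (`IsPartialIso.exists_isometry`) and ultrahomogeneity the
back-and-forth argument (`IsPartialIso.exists_isometryEquiv`).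

A generic map on some Polish space comes from Baire category among pseudometrics on `ℕ`
(`exists_isGeneric`): the completion realizes extensions approximately, and
`IsAdmissible.exists_exact` makes this exact. As `DistMap K` is hyperconvex, a value can always be
supplied, so the domain is itself a Urysohn space (`IsGeneric.forget`), and back-and-forth
identifies it with `U`. The case `E = Unit` yields the existence of Urysohn spaces. -/

/-- The data `(g, e)` prescribe a one-point extension of the points `x i` together with a value
of the `1`-Lipschitz map `F` at the new point. -/
structure IsAdmissible {V E ι : Type*} [PseudoMetricSpace V] [PseudoMetricSpace E] (F : V → E)
    (x : ι → V) (g : ι → ℝ) (e : E) : Prop where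
  sub_le : ∀ i j, g i - g j ≤ dist (x i) (x j)
  dist_le : ∀ i j, dist (x i) (x j) ≤ g i + g j
  val_le : ∀ i, dist (F (x i)) e ≤ g i

/-- Every admissible one-point extension of finitely many points is realized. -/
def IsGeneric {V E : Type*} [PseudoMetricSpace V] [PseudoMetricSpace E] (F : V → E) : Prop :=
  ∀ (n : ℕ) (x : Fin n → V) (g : Fin n → ℝ) (e : E), IsAdmissible F x g e →
    ∃ v, F v = e ∧ ∀ i, dist (x i) v = g i

/-- Every admissible one-point extension of the whole space is approximately realized on
finite sets. -/
def IsApproxGeneric {V E : Type*} [PseudoMetricSpace V] [PseudoMetricSpace E] (F : V → E) : Prop :=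
  ∀ (h : V → ℝ) (e : E), IsAdmissible F id h e → ∀ (A : Finset V) (ε : ℝ), 0 < ε →
    ∃ v, (∀ a ∈ A, |dist a v - h a| < ε) ∧ dist (F v) e < ε

/-! ### One-point extensions: from approximate to exact realization. -/

section Admissible

variable {V E ι : Type*} [PseudoMetricSpace V] [PseudoMetricSpace E] {F : V → E}

theorem IsAdmissible.comp {κ : Type*} {x : ι → V} {g : ι → ℝ} {e : E} (h : IsAdmissible F x g e)
    (σ : κ → ι) : IsAdmissible F (x ∘ σ) (g ∘ σ) e :=
  ⟨fun _ _ => h.sub_le _ _, fun _ _ => h.dist_le _ _, fun _ => h.val_le _⟩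

theorem IsAdmissible.of_point (hF : LipschitzWith 1 F) (x : ι → V) (u : V) :
    IsAdmissible F x (fun i => dist (x i) u) (F u) where
  sub_le i j := by linarith [dist_triangle (x i) (x j) u]
  dist_le i j := by linarith [dist_triangle_right (x i) (x j) u]
  val_le i := by simpa using hF.dist_le_mul (x i) u

/-- Approximately admissible data on finitely many points are close to data that are admissible
on the whole space. -/
theorem exists_isAdmissible_id_of_slack [Finite ι] [Nonempty ι] (hF : LipschitzWith 1 F)
    {x : ι → V} {g : ι → ℝ} {e : E} {ε : ℝ} (hε : 0 ≤ ε)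
    (h₁ : ∀ i j, g i - g j ≤ dist (x i) (x j) + ε)
    (h₂ : ∀ i j, dist (x i) (x j) ≤ g i + g j + ε) (h₃ : ∀ i, dist (F (x i)) e ≤ g i + ε) :
    ∃ h : V → ℝ, IsAdmissible F id h e ∧ ∀ i, g i ≤ h (x i) ∧ h (x i) ≤ g i + ε := by
  choose m hm using fun z : V => Finite.exists_min fun i => g i + dist z (x i)
  -- The Katětov extension `z ↦ min_i (g i + dist z (x i))`, raised by `ε` to absorb the slack.
  refine ⟨fun z => g (m z) + dist z (x (m z)) + ε, ⟨fun z w => ?_, fun z w => ?_, fun z => ?_⟩,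
    fun i => ⟨?_, ?_⟩⟩
  · have := hm z (m w)
    have := dist_triangle z w (x (m w))
    simp only [id]
    linarith
  · have := h₂ (m z) (m w)
    have := dist_triangle4 z (x (m z)) (x (m w)) w
    rw [dist_comm (x (m w)) w] at this
    simp only [id]
    linarith
  · have := h₃ (m z)
    have h4 := hF.dist_le_mul z (x (m z))
    have := dist_triangle (F z) (F (x (m z))) e
    simp only [NNReal.coe_one, one_mul, id] at *
    linarith
  · have := h₁ i (m (x i))
    linarith
  · have := hm (x i) i
    rw [dist_self] at this
    linarith

theorem IsAdmissible.exists_id [Finite ι] [Nonempty ι] (hF : LipschitzWith 1 F)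
    {x : ι → V} {g : ι → ℝ} {e : E} (h : IsAdmissible F x g e) :
    ∃ h : V → ℝ, IsAdmissible F id h e ∧ ∀ i, h (x i) = g i := by
  obtain ⟨k, hk, hkg⟩ := exists_isAdmissible_id_of_slack (ε := 0) hF le_rfl
    (fun i j => by simpa using h.sub_le i j) (fun i j => by simpa using h.dist_le i j)
    (fun i => by simpa using h.val_le i)
  exact ⟨k, hk, fun i => le_antisymm (by simpa using (hkg i).2) (hkg i).1⟩

theorem IsGeneric.exists_point [Finite ι] (hG : IsGeneric F) {x : ι → V} {g : ι → ℝ} {e : E}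
    (h : IsAdmissible F x g e) : ∃ v, F v = e ∧ ∀ i, dist (x i) v = g i := by
  obtain ⟨n, ⟨σ⟩⟩ := Finite.exists_equiv_fin ι
  obtain ⟨v, hv, hvx⟩ := hG n _ _ e (h.comp σ.symm)
  exact ⟨v, hv, fun i => by simpa using hvx (σ i)⟩

theorem IsAdmissible.exists_close {x : ι → V} [Finite ι] [Nonempty ι] (hF : LipschitzWith 1 F)
    (hA : IsApproxGeneric F) {g : ι → ℝ} {e : E}
    (h : IsAdmissible F x g e) {ε : ℝ} (hε : 0 < ε) :
    ∃ v, (∀ i, |dist (x i) v - g i| < ε) ∧ dist (F v) e < ε := by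
  obtain ⟨k, hk, hkg⟩ := h.exists_id hF
  obtain ⟨v, hv, hve⟩ := hA k e hk (Set.finite_range x).toFinset ε hε
  exact ⟨v, fun i => by simpa [hkg] using hv (x i) (by simp), hve⟩

/-- The point `v` joins the finite set, its prescribed distance from the new point being the largest
current error, which is below `ε`. The enlarged data are still admissible, and realizing them up to
`δ` gives a better point near `v`. -/
theorem IsAdmissible.exists_closer {x : ι → V} [Finite ι] (hF : LipschitzWith 1 F)
    (hA : IsApproxGeneric F) {g : ι → ℝ} {e : E}
    (h : IsAdmissible F x g e) {ε : ℝ} {v : V} (hv : ∀ i, |dist (x i) v - g i| < ε)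
    (hve : dist (F v) e < ε) {δ : ℝ} (hδ : 0 < δ) :
    ∃ w, (∀ i, |dist (x i) w - g i| < δ) ∧ dist (F w) e < δ ∧ dist v w < ε + δ := by
  -- The index `none` carries the error of the value, `some i` that of the distance to `x i`.
  obtain ⟨m, hm⟩ := Finite.exists_max fun o : Option ι =>
    o.elim (dist (F v) e) fun i => |dist (x i) v - g i|
  set φ : Option ι → ℝ := fun o => o.elim (dist (F v) e) fun i => |dist (x i) v - g i| with hφ
  have hmε : φ m < ε := by
    cases m with
    | none => exact hve
    | some i => exact hv i
  have hle : ∀ i, φ m ≤ g i + dist (x i) v := by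
    intro i
    cases m with
    | none =>
      have := h.val_le i
      have h4 := hF.dist_le_mul (x i) v
      have := dist_triangle_left (F v) e (F (x i))
      simp only [NNReal.coe_one, one_mul, hφ, Option.elim] at *
      linarith
    | some j =>
      have := h.sub_le j i
      have := h.dist_le j i
      have := dist_triangle (x j) (x i) v
      have := dist_triangle_right (x j) (x i) v
      simp only [hφ, Option.elim]
      rw [abs_le]
      constructor <;> linarith
  have hmi : ∀ i, |dist (x i) v - g i| ≤ φ m := fun i => hm (some i)
  have hmn : dist (F v) e ≤ φ m := hm none
  have hm0 : 0 ≤ φ m := dist_nonneg.trans hmn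
  have hadm : IsAdmissible F (fun o : Option ι => o.elim v x) (fun o => o.elim (φ m) g) e := by
    refine ⟨?_, ?_, ?_⟩
    · rintro (_ | i) (_ | j)
      · simp
      · have := hle j
        simp only [Option.elim]
        rw [dist_comm]
        linarith
      · have := abs_le.1 (hmi i)
        simp only [Option.elim]
        linarith
      · exact h.sub_le i j
    · rintro (_ | i) (_ | j)
      · simpa using hm0
      · have := abs_le.1 (hmi j)
        simp only [Option.elim]
        rw [dist_comm]
        linarith
      · have := abs_le.1 (hmi i)
        simp only [Option.elim]
        linarith
      · exact h.dist_le i j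
    · rintro (_ | i)
      · exact hmn
      · exact h.val_le i
  obtain ⟨w, hw, hwe⟩ := hadm.exists_close hF hA hδ
  refine ⟨w, fun i => hw (some i), hwe, ?_⟩
  have := abs_lt.1 (hw none)
  simp only [Option.elim] at this
  linarith

/-- Halving the error repeatedly moves the point by summable amounts; the limit is exact by
continuity. -/
theorem IsAdmissible.exists_exact {V E : Type*} [PseudoMetricSpace V] [MetricSpace E]
    {F : V → E} [CompleteSpace V] {x : ι → V} [Finite ι] [Nonempty ι]
    (hF : LipschitzWith 1 F) (hA : IsApproxGeneric F) {g : ι → ℝ} {e : E}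
    (h : IsAdmissible F x g e) : ∃ v, F v = e ∧ ∀ i, dist (x i) v = g i := by
  obtain ⟨v₀, hv₀⟩ := h.exists_close hF hA one_pos
  choose! step hstep using fun (ε : ℝ) (v : V)
    (hv : (0 < ε) ∧ (∀ i, |dist (x i) v - g i| < ε) ∧ dist (F v) e < ε) =>
    h.exists_closer hF hA hv.2.1 hv.2.2 (half_pos hv.1)
  let s : ℕ → V := fun n => Nat.rec v₀ (fun k v => step ((1 / 2) ^ k) v) n
  have hs : ∀ k, (∀ i, |dist (x i) (s k) - g i| < (1 / 2) ^ k) ∧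
      dist (F (s k)) e < (1 / 2) ^ k := by
    intro k
    induction k with
    | zero => simpa [s] using hv₀
    | succ k ih =>
      have := hstep _ (s k) ⟨by positivity, ih⟩
      rw [pow_succ, mul_one_div]
      exact ⟨this.1, this.2.1⟩
  have hd : ∀ k, dist (s k) (s (k + 1)) ≤ 2 * (1 / 2) ^ k := by
    intro k
    have := (hstep _ (s k) ⟨by positivity, hs k⟩).2.2
    have h0 : (0 : ℝ) < (1 / 2) ^ k := by positivity
    change dist (s k) (step _ (s k)) ≤ _
    linarith
  obtain ⟨v, hv⟩ := cauchySeq_tendsto_of_complete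
    (cauchySeq_of_le_geometric (1 / 2) 2 (by norm_num) hd)
  have h0 : Tendsto (fun k : ℕ => (1 / 2 : ℝ) ^ k) atTop (𝓝 0) :=
    tendsto_pow_atTop_nhds_zero_of_lt_one (by norm_num) (by norm_num)
  refine ⟨v, ?_, fun i => ?_⟩
  · exact tendsto_nhds_unique ((hF.continuous.tendsto v).comp hv)
      (tendsto_iff_dist_tendsto_zero.2
        (squeeze_zero (fun _ => dist_nonneg) (fun k => (hs k).2.le) h0))
  · exact tendsto_nhds_unique (tendsto_const_nhds.dist hv)
      (tendsto_iff_dist_tendsto_zero.2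
        (squeeze_zero (fun _ => dist_nonneg) (fun k => ((hs k).1 i).le) h0))

theorem IsApproxGeneric.isGeneric {V E : Type*} [PseudoMetricSpace V] [MetricSpace E]
    {F : V → E} [CompleteSpace V] [Nonempty V] (hF : LipschitzWith 1 F)
    (hA : IsApproxGeneric F) : IsGeneric F := by
  intro n x g e h
  cases n with
  | zero =>
    -- `exists_exact` needs at least one point, so an auxiliary base point is added.
    let v₀ : V := Classical.arbitrary V
    have hadm : IsAdmissible F (fun _ : Unit => v₀) (fun _ => dist (F v₀) e) e :=
      ⟨by simp, by simp, by simp⟩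
    obtain ⟨v, hv, -⟩ := hadm.exists_exact hF hA
    exact ⟨v, hv, fun i => i.elim0⟩
  | succ n => exact h.exists_exact hF hA

end Admissible

/-! ### The complete space of coded pseudometrics, and its dense open conditions. -/

/-- Pseudometrics on `ℕ` together with a `1`-Lipschitz map to `E`. -/
def metricCodes (E : Type*) [PseudoMetricSpace E] : Set ((ℕ → ℕ → ℝ) × (ℕ → E)) :=
  {p | (∀ i, p.1 i i = 0) ∧ (∀ i j, p.1 i j = p.1 j i) ∧
    (∀ i j k, p.1 i k ≤ p.1 i j + p.1 j k) ∧ ∀ i j, dist (p.2 i) (p.2 j) ≤ p.1 i j}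

section MetricCodes

variable {E : Type*} [PseudoMetricSpace E]

theorem isClosed_metricCodes : IsClosed (metricCodes E) := by
  simp only [metricCodes, Set.ofPred_and, Set.ofPred_forall]
  refine .inter ?_ (.inter ?_ (.inter ?_ ?_))
  · exact isClosed_iInter fun i => isClosed_eq (by fun_prop) (by fun_prop)
  · exact isClosed_iInter fun i => isClosed_iInter fun j => isClosed_eq (by fun_prop) (by fun_prop)
  · exact isClosed_iInter fun i => isClosed_iInter fun j => isClosed_iInter fun k =>
      isClosed_le (by fun_prop) (by fun_prop)
  · exact isClosed_iInter fun i => isClosed_iInter fun j => isClosed_le (by fun_prop) (by fun_prop)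

/-- The pseudometric space on `ℕ` given by a code. -/
def CodedSpace (_ : metricCodes E) : Type := ℕ

instance (p : metricCodes E) : PseudoMetricSpace (CodedSpace p) where
  dist i j := p.1.1 i j
  dist_self := p.2.1
  dist_comm := p.2.2.1
  dist_triangle := p.2.2.2.1

instance (p : metricCodes E) : Countable (CodedSpace p) := inferInstanceAs (Countable ℕ)

instance (p : metricCodes E) : Nonempty (CodedSpace p) := inferInstanceAs (Nonempty ℕ)

/-- The `1`-Lipschitz map given by a code. -/
def codedMap (p : metricCodes E) : CodedSpace p → E := p.1.2

theorem lipschitzWith_codedMap (p : metricCodes E) : LipschitzWith 1 (codedMap p) :=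
  LipschitzWith.of_dist_le_mul fun i j => by
    rw [NNReal.coe_one, one_mul]
    exact p.2.2.2.2 i j

/-- The codes in which the data `(g, e)` on the points `0, …, n` are either not admissible up to
`ε`, or are realized up to `2 * ε`. -/
def realizingCodes (n : ℕ) (g : Fin (n + 1) → ℚ) (e : E) (ε : ℝ) : Set (metricCodes E) :=
  {p | (∃ i j : Fin (n + 1), p.1.1 i j + ε < g i - g j) ∨
    (∃ i j : Fin (n + 1), g i + g j + ε < p.1.1 i j) ∨
    (∃ i : Fin (n + 1), g i + ε < dist (p.1.2 i) e) ∨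
    ∃ m, (∀ i : Fin (n + 1), |p.1.1 i m - g i| < 2 * ε) ∧ dist (p.1.2 m) e < 2 * ε}

theorem isOpen_realizingCodes (n : ℕ) (g : Fin (n + 1) → ℚ) (e : E) (ε : ℝ) :
    IsOpen (realizingCodes n g e ε) := by
  simp only [realizingCodes, Set.ofPred_or, Set.ofPred_exists, Set.ofPred_and, Set.ofPred_forall]
  refine .union ?_ (.union ?_ (.union ?_ ?_))
  · exact isOpen_iUnion fun i => isOpen_iUnion fun j => isOpen_lt (by fun_prop) (by fun_prop)
  · exact isOpen_iUnion fun i => isOpen_iUnion fun j => isOpen_lt (by fun_prop) (by fun_prop)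
  · exact isOpen_iUnion fun i => isOpen_lt (by fun_prop) (by fun_prop)
  · exact isOpen_iUnion fun m => .inter
      (isOpen_iInter_of_finite fun i => isOpen_lt (by fun_prop) (by fun_prop))
      (isOpen_lt (by fun_prop) (by fun_prop))

/-- Replace the point `N` of a coded space by a new point at distance `h i` from each `i ≠ N`. -/
def replacePoint (p : (ℕ → ℕ → ℝ) × (ℕ → E)) (h : ℕ → ℝ) (e : E) (N : ℕ) :
    (ℕ → ℕ → ℝ) × (ℕ → E) :=
  (fun i j => if i = N then (if j = N then 0 else h j) else if j = N then h i else p.1 i j,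
    fun i => if i = N then e else p.2 i)

theorem replacePoint_mem (p : metricCodes E) {h : ℕ → ℝ} {e : E}
    (hh : IsAdmissible (codedMap p) id h e) (N : ℕ) :
    replacePoint p.1 h e N ∈ metricCodes E := by
  obtain ⟨⟨d, F⟩, h0, hs, ht, hF⟩ := p
  have k1 : ∀ i j, h i - h j ≤ d i j := hh.sub_le
  have k2 : ∀ i j, d i j ≤ h i + h j := hh.dist_le
  have k3 : ∀ i, dist (F i) e ≤ h i := hh.val_le
  have k4 : ∀ i, 0 ≤ h i := fun i => dist_nonneg.trans (k3 i)
  refine ⟨fun i => ?_, fun i j => ?_, fun i j k => ?_, fun i j => ?_⟩ <;>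
    simp only [replacePoint] at *
  · have := h0 i
    split_ifs <;> trivial
  · have := hs i j
    split_ifs <;> trivial
  · have := k1 i j
    have := k1 k j
    have := k2 i k
    have := ht i j k
    have := hs j k
    have := k4 j
    split_ifs <;> linarith
  · have := k3 i
    have := k3 j
    have := hF i j
    split_ifs
    · simp
    · rwa [dist_comm]
    · assumption
    · assumption

/-- Each coordinate is unchanged once `N` exceeds its indices. -/
theorem tendsto_replacePoint (p : (ℕ → ℕ → ℝ) × (ℕ → E)) (h : ℕ → ℝ) (e : E) :
    Tendsto (replacePoint p h e) atTop (𝓝 p) := by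
  refine Tendsto.prodMk_nhds (tendsto_pi_nhds.2 fun i => tendsto_pi_nhds.2 fun j => ?_)
    (tendsto_pi_nhds.2 fun i => ?_)
  · refine tendsto_const_nhds.congr' ?_
    filter_upwards [eventually_gt_atTop i, eventually_gt_atTop j] with N hi hj
    simp [hi.ne, hj.ne]
  · refine tendsto_const_nhds.congr' ?_
    filter_upwards [eventually_gt_atTop i] with N hi
    simp [hi.ne]

/-- A code outside the set has data admissible up to `ε`. These extend to the whole coded space with
error at most `ε`, and a far-away point `N` can be sacrificed to realize the extension. -/
theorem dense_realizingCodes (n : ℕ) (g : Fin (n + 1) → ℚ) (e : E) {ε : ℝ} (hε : 0 < ε) :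
    Dense (realizingCodes n g e ε) := by
  intro p
  by_cases hp : p ∈ realizingCodes n g e ε
  · exact subset_closure hp
  obtain ⟨h1, h2, h3, -⟩ : (∀ i j : Fin (n + 1), (g i - g j : ℝ) ≤ p.1.1 i j + ε) ∧
      (∀ i j : Fin (n + 1), p.1.1 i j ≤ g i + g j + ε) ∧
      (∀ i : Fin (n + 1), dist (p.1.2 i) e ≤ g i + ε) ∧ True := by
    simp only [realizingCodes, Set.mem_ofPred_eq, not_or, not_exists, not_lt] at hp
    exact ⟨hp.1, hp.2.1, hp.2.2.1, trivial⟩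
  obtain ⟨h, hh, hg⟩ := exists_isAdmissible_id_of_slack (lipschitzWith_codedMap p)
    (x := fun i : Fin (n + 1) => (i : ℕ)) (g := fun i => (g i : ℝ)) (e := e) hε.le h1 h2 h3
  refine mem_closure_of_tendsto (f := fun N => (⟨_, replacePoint_mem p hh N⟩ : metricCodes E))
    (b := atTop) (tendsto_subtype_rng.2 (tendsto_replacePoint p.1 h e)) ?_
  filter_upwards [eventually_gt_atTop n] with N hN
  refine Or.inr (Or.inr (Or.inr ⟨N, fun i => ?_, ?_⟩))
  · have hi : (i : ℕ) ≠ N := by omega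
    have := hg i
    simp only [replacePoint, hi, if_true, if_false]
    rw [abs_lt]
    constructor <;> linarith
  · simpa [replacePoint] using hε

end MetricCodes

/-! ### A generic map from the Baire category theorem. -/

section Existence

variable (E : Type*) [MetricSpace E] [TopologicalSpace.SeparableSpace E] [Nonempty E]

/-- Rational data, a dense sequence of values and tolerances `1 / (k + 1)` leave countably many
dense open conditions. -/
theorem exists_metricCode_realizing [CompleteSpace E] : ∃ p : metricCodes E,
    ∀ (n : ℕ) (g : Fin (n + 1) → ℚ) (j k : ℕ), p ∈ realizingCodes n g (TopologicalSpace.denseSeq E j) (1 / (k + 1 : ℝ)) := by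
  have : CompleteSpace (metricCodes E) := isClosed_metricCodes.completeSpace_coe
  have : Nonempty (metricCodes E) :=
    ⟨⟨(fun _ _ => 0, fun _ => Classical.arbitrary E), by simp [metricCodes]⟩⟩
  obtain ⟨p, hp⟩ := (dense_iInter_of_isOpen
    (f := fun t : (Σ n : ℕ, Fin (n + 1) → ℚ) × ℕ × ℕ =>
      realizingCodes t.1.1 t.1.2 (TopologicalSpace.denseSeq E t.2.1) (1 / (t.2.2 + 1 : ℝ)))
    (fun _ => isOpen_realizingCodes _ _ _ _)
    (fun _ => dense_realizingCodes _ _ _ (by positivity))).nonempty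
  exact ⟨p, fun n g j k => Set.mem_iInter.1 hp (⟨n, g⟩, j, k)⟩

variable {E}

theorem isApproxGeneric_extension {p : metricCodes E}
    (hp : ∀ (n : ℕ) (g : Fin (n + 1) → ℚ) (j k : ℕ),
      p ∈ realizingCodes n g (TopologicalSpace.denseSeq E j) (1 / (k + 1 : ℝ))) :
    IsApproxGeneric (UniformSpace.Completion.extension (codedMap p)) := by
  intro h e hh A ε hε
  have hF : ∀ i : CodedSpace p, UniformSpace.Completion.extension (codedMap p) i = p.1.2 i :=
    fun i => UniformSpace.Completion.extension_coe (lipschitzWith_codedMap p).uniformContinuous i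
  have hd : ∀ i j : CodedSpace p, dist (i : UniformSpace.Completion (CodedSpace p)) j = p.1.1 i j :=
    fun i j => UniformSpace.Completion.dist_eq i j
  -- The distance errors add up to `4.5 * δ`: `δ` twice for replacing `a` by `idx a`, `δ / 2` for
  -- rounding `h`, and `2 * δ` from the code.
  obtain ⟨k, hk⟩ := exists_nat_one_div_lt (show 0 < ε / 5 by positivity)
  set δ : ℝ := 1 / (k + 1 : ℝ) with hδ
  have hδ0 : 0 < δ := by positivity
  choose idx hidx using fun a : UniformSpace.Completion (CodedSpace p) =>
    Metric.denseRange_iff.1 UniformSpace.Completion.denseRange_coe a δ hδ0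
  let ν : CodedSpace p → ℕ := fun i => i
  let toC : ℕ → CodedSpace p := fun i => i
  let n : ℕ := A.sup fun a => ν (idx a)
  choose g hg using fun i : Fin (n + 1) => exists_rat_btwn
    (show h (toC i : CodedSpace p) < h (toC i : CodedSpace p) + δ / 2 by linarith)
  obtain ⟨j, hj⟩ := Metric.denseRange_iff.1 (TopologicalSpace.denseRange_denseSeq E) e (δ / 2)
    (by positivity)
  -- Rounding costs less than `δ`, so the first three alternatives contradict the admissibility of
  -- `h`.
  rcases hp n g j k with ⟨i, i', hi⟩ | ⟨i, i', hi⟩ | ⟨i, hi⟩ | ⟨m, hm, hme⟩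
  · have := hh.sub_le (toC i : CodedSpace p) (toC i' : CodedSpace p)
    simp only [id, hd] at this
    have : h (toC i) - h (toC i') ≤ p.1.1 i i' := this
    linarith [hg i, hg i']
  · have := hh.dist_le (toC i : CodedSpace p) (toC i' : CodedSpace p)
    simp only [id, hd] at this
    have : p.1.1 i i' ≤ h (toC i) + h (toC i') := this
    linarith [hg i, hg i']
  · have := hh.val_le (toC i : CodedSpace p)
    simp only [id, hF] at this
    have : dist (p.1.2 i) e ≤ h (toC i) := this
    linarith [hg i, dist_triangle (p.1.2 i) e (TopologicalSpace.denseSeq E j)]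
  · refine ⟨(toC m : CodedSpace p), fun a ha => ?_, ?_⟩
    · have hn : ν (idx a) < n + 1 :=
        Nat.lt_succ_of_le (Finset.le_sup (f := fun a => ν (idx a)) ha)
      have h1 := hm ⟨ν (idx a), hn⟩
      have h2 := hg ⟨ν (idx a), hn⟩
      have h3 := hidx a
      have h4 := hh.sub_le a (idx a)
      have h5 := hh.sub_le (idx a) a
      have h6 := hd (idx a) (toC m)
      have h7 := dist_triangle a (idx a) (toC m)
      have h8 := dist_triangle_left (idx a : UniformSpace.Completion (CodedSpace p)) (toC m) a
      rw [dist_comm] at h5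
      simp only [id] at h4 h5
      change |p.1.1 (idx a) (toC m) - g ⟨ν (idx a), hn⟩| < 2 * δ at h1
      change h (idx a) < g ⟨ν (idx a), hn⟩ ∧ g ⟨ν (idx a), hn⟩ < h (idx a) + δ / 2 at h2
      rw [← h6, abs_lt] at h1
      rw [abs_lt]
      constructor <;> linarith
    · rw [hF]
      have := dist_triangle_right (p.1.2 m) e (TopologicalSpace.denseSeq E j)
      change dist (p.1.2 m) e < ε
      linarith

variable (E) in
theorem exists_isGeneric [CompleteSpace E] :
    ∃ (V : Type) (_ : MetricSpace V), CompleteSpace V ∧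
    TopologicalSpace.SeparableSpace V ∧ Nonempty V ∧ ∃ F : V → E, LipschitzWith 1 F ∧ IsGeneric F := by
  obtain ⟨p, hp⟩ := exists_metricCode_realizing E
  have hF := (lipschitzWith_codedMap p).completion_extension
  have : Nonempty (UniformSpace.Completion (CodedSpace p)) :=
    Nonempty.map (↑) (inferInstance : Nonempty (CodedSpace p))
  exact ⟨UniformSpace.Completion (CodedSpace p), inferInstance, inferInstance, inferInstance,
    inferInstance, _, hF, (isApproxGeneric_extension hp).isGeneric hF⟩

end Existence

/-! ### Back-and-forth for spaces with a map to `E`. -/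

/-- `R` is (the graph of) a partial isometry which carries `F` to `G`. -/
def IsPartialIso {U V E : Type*} [PseudoMetricSpace U] [PseudoMetricSpace V] (F : U → E)
    (G : V → E) (R : Set (U × V)) : Prop :=
  (∀ p ∈ R, F p.1 = G p.2) ∧ ∀ p ∈ R, ∀ q ∈ R, dist p.1 q.1 = dist p.2 q.2

section PartialIso

variable {U V E : Type*} [MetricSpace U] [MetricSpace V] {F : U → E} {G : V → E}
  {R : Set (U × V)}

theorem IsPartialIso.swap (h : IsPartialIso F G R) : IsPartialIso G F (Prod.swap ⁻¹' R) :=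
  ⟨fun p hp => (h.1 p.swap hp).symm, fun p hp q hq => (h.2 p.swap hp q.swap hq).symm⟩

/-- If first coordinates converge to `u`, the second ones are Cauchy, since `R` preserves distances.
-/
theorem IsPartialIso.exists_mem [CompleteSpace V] (h : IsPartialIso F G R) (hR : IsClosed R)
    (hd : Dense (Prod.fst '' R)) (u : U) : ∃ v, (u, v) ∈ R := by
  obtain ⟨a, ha, hau⟩ := mem_closure_iff_seq_limit.1 (hd u)
  choose p hp hpa using ha
  have hc : CauchySeq fun n => (p n).2 := by
    have := hau.cauchySeq
    rw [Metric.cauchySeq_iff] at this ⊢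
    simpa only [← h.2 _ (hp _) _ (hp _), hpa] using this
  obtain ⟨v, hv⟩ := cauchySeq_tendsto_of_complete hc
  refine ⟨v, hR.mem_of_tendsto (hau.prodMk_nhds hv) (Eventually.of_forall fun n => ?_)⟩
  rw [← hpa n]
  exact hp n

theorem IsPartialIso.snd_eq (h : IsPartialIso F G R) {u : U} {v w : V} (hv : (u, v) ∈ R)
    (hw : (u, w) ∈ R) : v = w := by
  simpa [eq_comm] using h.2 _ hv _ hw

theorem IsPartialIso.exists_superset (h : IsPartialIso F G R) (hR : R.Finite)
    {s : Set U} {t : Set V} (hs : s.Countable) (ht : t.Countable)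
    (hforth : ∀ R : Set (U × V), R.Finite → IsPartialIso F G R → ∀ u ∈ s,
      ∃ v, IsPartialIso F G (insert (u, v) R))
    (hback : ∀ R : Set (U × V), R.Finite → IsPartialIso F G R → ∀ v ∈ t,
      ∃ u, IsPartialIso F G (insert (u, v) R)) :
    ∃ R', R ⊆ R' ∧ IsPartialIso F G R' ∧ s ⊆ Prod.fst '' R' ∧ t ⊆ Prod.snd '' R' := by
  have := hs.to_subtype
  have := ht.to_subtype
  let _ : Encodable (s ⊕ t) := Encodable.ofCountable _
  let P := {R : Set (U × V) // R.Finite ∧ IsPartialIso F G R}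
  let 𝒟 : s ⊕ t → Order.Cofinal P := Sum.elim
    (fun u => ⟨{R | (u : U) ∈ Prod.fst '' R.1}, fun R => by
      obtain ⟨v, hv⟩ := hforth R.1 R.2.1 R.2.2 u u.2
      exact ⟨⟨_, R.2.1.insert _, hv⟩, ⟨_, Set.mem_insert _ _, rfl⟩, Set.subset_insert _ _⟩⟩)
    (fun v => ⟨{R | (v : V) ∈ Prod.snd '' R.1}, fun R => by
      obtain ⟨u, hu⟩ := hback R.1 R.2.1 R.2.2 v v.2
      exact ⟨⟨_, R.2.1.insert _, hu⟩, ⟨_, Set.mem_insert _ _, rfl⟩, Set.subset_insert _ _⟩⟩)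
  -- Rasiowa–Sikorski: a directed family of finite partial isometries meets all the countably many
  -- requirements, and its union is the required relation.
  let I := Order.idealOfCofinals (⟨R, hR, h⟩ : P) 𝒟
  refine ⟨⋃ Q ∈ I, Q.1, ?_, ⟨?_, ?_⟩, ?_, ?_⟩
  · exact fun p hp => Set.mem_biUnion (Order.mem_idealOfCofinals _ 𝒟) hp
  · intro p hp
    obtain ⟨Q, -, hpQ⟩ := Set.mem_iUnion₂.1 hp
    exact Q.2.2.1 p hpQ
  · intro p hp q hq
    obtain ⟨Q, hQ, hpQ⟩ := Set.mem_iUnion₂.1 hp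
    obtain ⟨Q', hQ', hqQ⟩ := Set.mem_iUnion₂.1 hq
    obtain ⟨Q'', -, h1, h2⟩ := I.directed Q hQ Q' hQ'
    exact Q''.2.2.2 p (h1 hpQ) q (h2 hqQ)
  · intro u hu
    obtain ⟨Q, ⟨p, hp, rfl⟩, hQI⟩ :=
      Order.cofinal_meets_idealOfCofinals (⟨R, hR, h⟩ : P) 𝒟 (Sum.inl ⟨u, hu⟩)
    exact ⟨p, Set.mem_biUnion hQI hp, rfl⟩
  · intro v hv
    obtain ⟨Q, ⟨p, hp, rfl⟩, hQI⟩ :=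
      Order.cofinal_meets_idealOfCofinals (⟨R, hR, h⟩ : P) 𝒟 (Sum.inr ⟨v, hv⟩)
    exact ⟨p, Set.mem_biUnion hQI hp, rfl⟩

variable [MetricSpace E]

/-- The distances to `u` and the value `F u` are admissible on the domain of `R`, hence on its
range, where genericity of `G` realizes them. -/
theorem IsPartialIso.exists_insert (hF : LipschitzWith 1 F) (hG : IsGeneric G)
    (h : IsPartialIso F G R) (hR : R.Finite) (u : U) :
    ∃ v, IsPartialIso F G (insert (u, v) R) := by
  have := hR.to_subtype
  have hadm := IsAdmissible.of_point hF (fun p : R => p.1.1) u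
  obtain ⟨v, hv, hvR⟩ := hG.exists_point (x := fun p : R => p.1.2)
    (g := fun p : R => dist p.1.1 u) (e := F u)
    ⟨fun i j => by rw [← h.2 _ i.2 _ j.2]; exact hadm.sub_le i j,
      fun i j => by rw [← h.2 _ i.2 _ j.2]; exact hadm.dist_le i j,
      fun i => by rw [← h.1 _ i.2]; exact hadm.val_le i⟩
  refine ⟨v, ?_, ?_⟩
  · rintro p (rfl | hp)
    · exact hv.symm
    · exact h.1 p hp
  · rintro p (rfl | hp) q (rfl | hq)
    · simp
    · rw [dist_comm, dist_comm v, hvR ⟨q, hq⟩]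
    · rw [hvR ⟨p, hp⟩]
    · exact h.2 p hp q hq

theorem IsPartialIso.exists_insert_left (hG : LipschitzWith 1 G) (hF : IsGeneric F)
    (h : IsPartialIso F G R) (hR : R.Finite) (v : V) :
    ∃ u, IsPartialIso F G (insert (u, v) R) := by
  obtain ⟨u, hu⟩ := h.swap.exists_insert hG hF (hR.preimage Prod.swap_injective.injOn) v
  refine ⟨u, ?_⟩
  convert hu.swap using 1
  ext ⟨a, b⟩
  simp [and_comm]

theorem IsPartialIso.closure (hF : Continuous F) (hG : Continuous G) (h : IsPartialIso F G R) :
    IsPartialIso F G (closure R) := by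
  refine ⟨fun p hp => ?_, fun p hp q hq => ?_⟩
  · exact closure_minimal (s := R) (t := {p | F p.1 = G p.2}) h.1
      (isClosed_eq (by fun_prop) (by fun_prop)) hp
  · have : (p, q) ∈ _root_.closure (R ×ˢ R) := by
      rw [closure_prod_eq]
      exact ⟨hp, hq⟩
    exact closure_minimal (t := {z : (U × V) × (U × V) | dist z.1.1 z.2.1 = dist z.1.2 z.2.2})
      (fun z hz => h.2 _ hz.1 _ hz.2) (isClosed_eq (by fun_prop) (by fun_prop)) this

theorem IsPartialIso.exists_isometry [TopologicalSpace.SeparableSpace U] [CompleteSpace V]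
    (hF : LipschitzWith 1 F) (hG : Continuous G) (hGG : IsGeneric G)
    (h : IsPartialIso F G R) (hR : R.Finite) :
    ∃ ι : U → V, Isometry ι ∧ (∀ u, G (ι u) = F u) ∧ ∀ p ∈ R, ι p.1 = p.2 := by
  obtain ⟨s, hs, hsd⟩ := TopologicalSpace.exists_countable_dense U
  obtain ⟨R', hRR', hR', hs', -⟩ := h.exists_superset hR hs Set.countable_empty
    (fun R hR h u _ => h.exists_insert hF hGG hR u) (fun _ _ _ v hv => hv.elim)
  have hcl := hR'.closure hF.continuous hG
  choose ι hι using hcl.exists_mem isClosed_closure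
    (hsd.mono (hs'.trans (Set.image_mono subset_closure)))
  exact ⟨ι, Isometry.of_dist_eq fun u w => (hcl.2 _ (hι u) _ (hι w)).symm,
    fun u => (hcl.1 _ (hι u)).symm,
    fun p hp => hcl.snd_eq (hι p.1) (subset_closure (hRR' hp))⟩

theorem IsPartialIso.exists_isometryEquiv [TopologicalSpace.SeparableSpace U]
    [TopologicalSpace.SeparableSpace V] [CompleteSpace U] [CompleteSpace V]
    (hF : LipschitzWith 1 F) (hG : LipschitzWith 1 G) (hFF : IsGeneric F) (hGG : IsGeneric G)
    (h : IsPartialIso F G R) (hR : R.Finite) :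
    ∃ Φ : U ≃ᵢ V, (∀ u, G (Φ u) = F u) ∧ ∀ p ∈ R, Φ p.1 = p.2 := by
  obtain ⟨s, hs, hsd⟩ := TopologicalSpace.exists_countable_dense U
  obtain ⟨t, ht, htd⟩ := TopologicalSpace.exists_countable_dense V
  obtain ⟨R', hRR', hR', hs', ht'⟩ := h.exists_superset hR hs ht
    (fun R hR h u _ => h.exists_insert hF hGG hR u)
    (fun R hR h v _ => h.exists_insert_left hG hFF hR v)
  have hcl := hR'.closure hF.continuous hG.continuous
  choose f hf using hcl.exists_mem isClosed_closure
    (hsd.mono (hs'.trans (Set.image_mono subset_closure)))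
  choose g hg using hcl.swap.exists_mem (isClosed_closure.preimage continuous_swap) (by
    refine htd.mono (ht'.trans ?_)
    rintro _ ⟨p, hp, rfl⟩
    exact ⟨p.swap, subset_closure hp, rfl⟩)
  exact ⟨IsometryEquiv.mk' f g (fun v => hcl.snd_eq (hf (g v)) (hg v))
      (Isometry.of_dist_eq fun u w => (hcl.2 _ (hf u) _ (hf w)).symm),
    fun u => (hcl.1 _ (hf u)).symm,
    fun p hp => hcl.snd_eq (hf p.1) (subset_closure (hRR' hp))⟩

end PartialIso

/-! ### Urysohn spaces as the generic spaces for `E = Unit`. -/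

section Urysohn

theorem IsUrysohnSpace.isGeneric {U : Type*} [MetricSpace U] (hU : IsUrysohnSpace U) :
    IsGeneric fun _ : U => () := by
  intro n x g e h
  have h0 : ∀ i, 0 ≤ g i := fun i => dist_nonneg.trans (h.val_le i)
  let _ : PseudoMetricSpace (Option (Fin n)) :=
    { dist := fun a b => a.elim (b.elim 0 g) fun i => b.elim (g i) fun j => dist (x i) (x j)
      dist_self := by rintro (_ | i) <;> simp
      dist_comm := by
        rintro (_ | i) (_ | j)
        · rfl
        · rfl
        · rfl
        · exact dist_comm _ _
      dist_triangle := by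
        rintro (_ | i) (_ | j) (_ | k) <;> simp only [Option.elim]
        · simp
        · simp
        · linarith [h0 j]
        · linarith [h.sub_le k j, dist_comm (x k) (x j)]
        · simp
        · exact h.dist_le i k
        · linarith [h.sub_le i j]
        · exact dist_triangle _ _ _ }
  -- Points `x i` may repeat and `g i` may vanish, so `Option (Fin n)` is only pseudometric.
  let M := SeparationQuotient (Option (Fin n))
  let q : Option (Fin n) → M := SeparationQuotient.mk
  have hq : ∀ a b, dist (q a) (q b) = dist a b := SeparationQuotient.dist_mk
  have : Finite M := Finite.of_surjective q SeparationQuotient.surjective_mk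
  let S : Set M := Set.range fun i => q (some i)
  choose σ hσ using fun s : S => s.2
  have hf : Isometry fun s : S => x (σ s) := Isometry.of_dist_eq fun s t => by
    have := hq (some (σ s)) (some (σ t))
    simp only at hσ
    rw [hσ, hσ] at this
    exact this.symm
  obtain ⟨G, hG, hGS⟩ := hU.extension M S _ hf
  have hGx : ∀ i, G (q (some i)) = x i := by
    intro i
    rw [hGS ⟨q (some i), i, rfl⟩]
    have h1 := hq (some (σ ⟨q (some i), i, rfl⟩)) (some i)
    simp only at hσ
    rw [hσ, dist_self] at h1
    exact dist_eq_zero.1 h1.symm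
  refine ⟨G (q none), rfl, fun i => ?_⟩
  rw [← hGx, hG.dist_eq, hq]
  rfl

theorem IsGeneric.isUrysohnSpace {V : Type*} [MetricSpace V] [CompleteSpace V]
    [TopologicalSpace.SeparableSpace V] (hV : IsGeneric fun _ : V => ()) : IsUrysohnSpace V where
  complete := inferInstance
  separable := inferInstance
  extension M _ _ S f hf := by
    have hR : IsPartialIso (fun _ : M => ()) (fun _ : V => ())
        (Set.range fun s : S => ((s : M), f s)) := by
      refine ⟨fun _ _ => rfl, ?_⟩
      rintro _ ⟨s, rfl⟩ _ ⟨t, rfl⟩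
      exact (hf.dist_eq s t).symm
    obtain ⟨ι, hι, -, hιR⟩ := hR.exists_isometry (LipschitzWith.const' ()) continuous_const hV
      (Set.finite_range _)
    exact ⟨ι, hι, fun s => hιR _ ⟨s, rfl⟩⟩

theorem IsGeneric.comp_isometryEquiv {U V E : Type*} [PseudoMetricSpace U] [PseudoMetricSpace V]
    [PseudoMetricSpace E] {F : V → E} (hF : IsGeneric F) (Φ : U ≃ᵢ V) : IsGeneric (F ∘ Φ) := by
  intro n x g e h
  obtain ⟨v, hv, hvx⟩ := hF n (Φ ∘ x) g e ⟨fun i j => (h.sub_le i j).trans_eq (Φ.dist_eq _ _).symm,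
    fun i j => (Φ.dist_eq _ _).trans_le (h.dist_le i j), fun i => h.val_le i⟩
  exact ⟨Φ.symm v, by simpa using hv, fun i => by rw [← hvx, ← Φ.dist_eq]; simp⟩

theorem exists_isUrysohnSpace : ∃ (U : Type*) (_ : MetricSpace U), IsUrysohnSpace U := by
  obtain ⟨V, _, _, _, _, F, -, hF⟩ := exists_isGeneric Unit
  -- `exists_isGeneric` produces a space in `Type`; `ULift` moves it to any universe.
  let Φ : ULift V ≃ᵢ V := IsometryEquiv.mk' ULift.down ULift.up (fun _ => rfl)
    (Isometry.of_dist_eq fun _ _ => rfl)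
  have hF' : IsGeneric fun _ : ULift V => () := hF.comp_isometryEquiv Φ
  have : TopologicalSpace.SeparableSpace (ULift V) :=
    Φ.symm.surjective.denseRange.separableSpace Φ.symm.continuous
  exact ⟨ULift V, inferInstance, hF'.isUrysohnSpace⟩

end Urysohn

/-! ### The value space `DistMap K` and the transfer of a generic map to `U`. -/

section DistMap

variable {K : Type*} [MetricSpace K]

variable (K) in
/-- The nonnegative `1`-Lipschitz functions on `K`, with the supremum metric. -/
abbrev DistMap : Type _ := {f : C(K, ℝ) // (∀ k, 0 ≤ f k) ∧ ∀ k l, f k ≤ f l + dist k l}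

namespace DistMap

/-- Bundle a nonnegative `1`-Lipschitz function. -/
def mk (f : K → ℝ) (h0 : ∀ k, 0 ≤ f k) (h : ∀ k l, f k ≤ f l + dist k l) : DistMap K :=
  ⟨⟨f, (LipschitzWith.of_le_add h).continuous⟩, h0, h⟩

@[simp]
theorem mk_apply {f : K → ℝ} (h0 : ∀ k, 0 ≤ f k) (h : ∀ k l, f k ≤ f l + dist k l) (k : K) :
    (mk f h0 h).1 k = f k := rfl

instance : Nonempty (DistMap K) := ⟨mk (fun _ => 0) (fun _ => le_rfl) fun _ _ => by simp⟩

variable [CompactSpace K]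

instance : CompleteSpace (DistMap K) := by
  have : IsClosed {f : C(K, ℝ) | (∀ k, 0 ≤ f k) ∧ ∀ k l, f k ≤ f l + dist k l} := by
    simp only [Set.ofPred_and, Set.ofPred_forall]
    exact .inter (isClosed_iInter fun k => isClosed_le (by fun_prop) (by fun_prop))
      (isClosed_iInter fun k => isClosed_iInter fun l => isClosed_le (by fun_prop) (by fun_prop))
  exact this.completeSpace_coe

theorem dist_le {f g : DistMap K} {r : ℝ} (hr : 0 ≤ r) :
    dist f g ≤ r ↔ ∀ k, |f.1 k - g.1 k| ≤ r :=
  ContinuousMap.dist_le hr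

theorem apply_le_add_dist {X : Type*} [PseudoMetricSpace X] {F : X → DistMap K}
    (hF : LipschitzWith 1 F) (x y : X) (k : K) : (F x).1 k ≤ (F y).1 k + dist x y := by
  have h := (dist_le dist_nonneg).1 ((hF.dist_le_mul x y).trans_eq (one_mul _)) k
  linarith [abs_le.1 h]

theorem lipschitzWith {X : Type*} [PseudoMetricSpace X] {F : X → DistMap K}
    (hF : ∀ x y k, (F x).1 k ≤ (F y).1 k + dist x y) : LipschitzWith 1 F :=
  LipschitzWith.of_dist_le_mul fun x y => by
    rw [NNReal.coe_one, one_mul, dist_le dist_nonneg]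
    intro k
    have := hF x y k
    have := hF y x k
    rw [dist_comm] at this
    rw [abs_le]
    constructor <;> linarith

end DistMap

variable [CompactSpace K]

/-- The space of nonnegative `1`-Lipschitz functions is hyperconvex: a value at the new point can
always be found. -/
theorem IsAdmissible.exists_distMap {V ι : Type*} [MetricSpace V] [Finite ι] {F : V → DistMap K}
    (hF : LipschitzWith 1 F) {x : ι → V} {g : ι → ℝ}
    (h : IsAdmissible (fun _ : V => ()) x g ()) : ∃ e, IsAdmissible F x g e := by
  -- The new value is `φ k = max (0, max_i (F (x i) k - g i))`, the least nonnegative function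
  -- meeting the lower bounds; the upper bounds follow from `h.dist_le`.
  choose m hm using fun k : K => Finite.exists_max fun o : Option ι =>
    o.elim 0 fun i => (F (x i)).1 k - g i
  set φ : K → ℝ := fun k => (m k).elim 0 fun i => (F (x i)).1 k - g i with hφ
  have hφ0 : ∀ k, 0 ≤ φ k := fun k => hm k none
  have hφi : ∀ k i, (F (x i)).1 k - g i ≤ φ k := fun k i => hm k (some i)
  have hg : ∀ i, 0 ≤ g i := fun i => dist_nonneg.trans (h.val_le i)
  refine ⟨DistMap.mk φ hφ0 fun k l => ?_, h.sub_le, h.dist_le, fun i => ?_⟩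
  · rcases hk : m k with _ | i
    · have : φ k = 0 := by simp [hφ, hk]
      linarith [hφ0 l, dist_nonneg (x := k) (y := l)]
    · have : φ k = (F (x i)).1 k - g i := by simp [hφ, hk]
      linarith [hφi l i, (F (x i)).2.2 k l]
  · rw [DistMap.dist_le (hg i)]
    intro k
    have h1 := hφi k i
    have h2 := (F (x i)).2.1 k
    simp only [DistMap.mk_apply]
    rw [abs_le]
    refine ⟨?_, by linarith⟩
    rcases hk : m k with _ | j
    · have : φ k = 0 := by simp [hφ, hk]
      linarith [hg i]
    · have : φ k = (F (x j)).1 k - g j := by simp [hφ, hk]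
      linarith [DistMap.apply_le_add_dist hF (x j) (x i) k, h.dist_le j i]

theorem IsGeneric.forget {V : Type*} [MetricSpace V] {F : V → DistMap K}
    (hF : LipschitzWith 1 F) (hG : IsGeneric F) : IsGeneric fun _ : V => () := by
  intro n x g _ h
  obtain ⟨e, he⟩ := h.exists_distMap hF
  obtain ⟨v, -, hv⟩ := hG n x g e he
  exact ⟨v, rfl, hv⟩

variable (K) in
theorem IsUrysohnSpace.exists_isGeneric_distMap {U : Type*} [MetricSpace U]
    (hU : IsUrysohnSpace U) : ∃ F : U → DistMap K, LipschitzWith 1 F ∧ IsGeneric F := by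
  have := hU.complete
  have := hU.separable
  obtain ⟨V, _, _, _, _, F, hF, hG⟩ := exists_isGeneric (DistMap K)
  have hR : IsPartialIso (fun _ : U => ()) (fun _ : V => ()) ∅ := ⟨by simp, by simp⟩
  obtain ⟨Φ, -⟩ := hR.exists_isometryEquiv (LipschitzWith.const' ()) (LipschitzWith.const' ())
    hU.isGeneric (hG.forget hF) Set.finite_empty
  exact ⟨F ∘ Φ, by simpa using hF.comp Φ.isometry.lipschitz, hG.comp_isometryEquiv Φ⟩

theorem SumProd.dist_mk {X Y : Type*} [MetricSpace X] [MetricSpace Y] (x x' : X) (y y' : Y) :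
    dist (SumProd.mk x y) (SumProd.mk x' y') = dist x x' + dist y y' := by
  simp [WithLp.prod_dist_eq_add (p := 1) (by simp)]

/-- The distance functions of the points of `X` to a subset of `X × K`. -/
noncomputable def distMapOf {X : Type*} [MetricSpace X] (D : Set (SumProd X K)) (x : X) :
    DistMap K :=
  DistMap.mk (fun k => Metric.infDist (SumProd.mk x k) D) (fun _ => Metric.infDist_nonneg)
    fun k l => by
      simpa [SumProd.dist_mk] using
        Metric.infDist_le_infDist_add_dist (s := D) (x := SumProd.mk x k) (y := SumProd.mk x l)

theorem lipschitzWith_distMapOf {X : Type*} [MetricSpace X] (D : Set (SumProd X K)) :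
    LipschitzWith 1 (distMapOf D) :=
  DistMap.lipschitzWith fun x y k => by
    simpa [SumProd.dist_mk, distMapOf] using
      Metric.infDist_le_infDist_add_dist (s := D) (x := SumProd.mk x k) (y := SumProd.mk y k)

/-- The zero set of a map to the space of nonnegative `1`-Lipschitz functions on `K`. -/
def zeroLocus {U : Type*} (F : U → DistMap K) : Set (SumProd U K) :=
  {p | (F p.fst).1 p.snd = 0}

/-! ### Universality and ultrahomogeneity of the zero locus. -/

section ZeroLocus

variable {U : Type*} [MetricSpace U] {F : U → DistMap K}

theorem isClosed_zeroLocus (hF : LipschitzWith 1 F) : IsClosed (zeroLocus F) := by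
  have hc : LipschitzWith 1 fun p : SumProd U K => (F p.fst).1 p.snd :=
    LipschitzWith.of_le_add fun p q => by
      have h1 := DistMap.apply_le_add_dist hF p.fst q.fst p.snd
      have h2 := (F q.fst).2.2 p.snd q.snd
      have h3 := SumProd.dist_mk p.fst q.fst p.snd q.snd
      change dist p q = _ at h3
      linarith
  exact isClosed_eq hc.continuous continuous_const

theorem infDist_zeroLocus (hF : LipschitzWith 1 F) (hG : IsGeneric F) (x : U) (k : K) :
    Metric.infDist (SumProd.mk x k) (zeroLocus F) = (F x).1 k := by
  -- With `r = F x k`, the function `max (F x - r, 0)` vanishes at `k` and lies within `r` of `F x`.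
  -- A point `v` at distance `r` from `x` with this value puts `(v, k)` in the locus.
  let e : DistMap K := DistMap.mk (fun l => max ((F x).1 l - (F x).1 k) 0)
    (fun _ => le_max_right _ _) fun l m => by
      have := (F x).2.2 l m
      rcases max_cases ((F x).1 l - (F x).1 k) 0 with h | h <;>
      rcases max_cases ((F x).1 m - (F x).1 k) 0 with h' | h' <;>
      linarith [dist_nonneg (x := l) (y := m)]
  have h0 := (F x).2.1
  obtain ⟨v, hv, hxv⟩ := hG 1 (fun _ => x) (fun _ => (F x).1 k) e
    ⟨fun _ _ => by simp, fun _ _ => by simpa using h0 k, fun _ => by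
      rw [DistMap.dist_le (h0 k)]
      intro l
      have := h0 l
      have := h0 k
      simp only [e, DistMap.mk_apply]
      rw [abs_le]
      rcases max_cases ((F x).1 l - (F x).1 k) 0 with h | h <;> constructor <;> linarith⟩
  have hmem : SumProd.mk v k ∈ zeroLocus F := by
    change (F v).1 k = 0
    simp [hv, e]
  refine le_antisymm ?_ ((Metric.le_infDist ⟨_, hmem⟩).2 ?_)
  · have := Metric.infDist_le_dist_of_mem (x := SumProd.mk x k) hmem
    rwa [SumProd.dist_mk, hxv 0, dist_self, add_zero] at this
  · intro p hp
    have h1 := DistMap.apply_le_add_dist hF x p.fst k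
    have h2 := (F p.fst).2.2 k p.snd
    have h3 := SumProd.dist_mk x p.fst k p.snd
    change (F p.fst).1 p.snd = 0 at hp
    change dist _ p = _ at h3
    linarith

theorem isUniversalClosedSubset_zeroLocus [CompleteSpace U] (hF : LipschitzWith 1 F)
    (hG : IsGeneric F) : IsUniversalClosedSubset (zeroLocus F) := by
  intro X _ _ _ D hD
  have key : ∀ G : X → DistMap K, LipschitzWith 1 G →
      ∃ ι : X → U, Isometry ι ∧ ∀ x, F (ι x) = G x := by
    intro G hGL
    have hR : IsPartialIso G F ∅ := ⟨by simp, by simp⟩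
    obtain ⟨ι, hι, hιG, -⟩ := hR.exists_isometry hGL hF.continuous hG Set.finite_empty
    exact ⟨ι, hι, hιG⟩
  -- `Metric.infDist` to the empty set is `0` by default, so `distMapOf ∅` would put every point in
  -- the locus; a strictly positive map replaces it.
  rcases D.eq_empty_or_nonempty with rfl | hne
  · rcases isEmpty_or_nonempty X with hX | ⟨⟨x₀⟩⟩
    · exact ⟨fun x => isEmptyElim x, fun x => isEmptyElim x, fun x => isEmptyElim x, by simp⟩
    · obtain ⟨ι, hι, hιG⟩ := key (fun x => DistMap.mk (fun _ => dist x x₀ + 1)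
        (fun _ => by positivity) (fun _ _ => by simp)) (DistMap.lipschitzWith fun x y k => by
          simp only [DistMap.mk_apply]
          linarith [dist_triangle x y x₀])
      refine ⟨ι, hι, fun x k => ?_, by simp⟩
      have hpos : (F (ι x)).1 k ≠ 0 := by
        rw [hιG, DistMap.mk_apply]
        positivity
      exact iff_of_false (Set.notMem_empty _) hpos
  · obtain ⟨ι, hι, hιG⟩ := key (distMapOf D) (lipschitzWith_distMapOf D)
    have hd : ∀ x k, (F (ι x)).1 k = Metric.infDist (SumProd.mk x k) D := fun x k => by
      rw [hιG]
      rfl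
    refine ⟨ι, hι, fun x k => ?_, fun _ x k => ?_⟩
    · rw [hD.mem_iff_infDist_zero hne, ← hd]
      rfl
    · rw [infDist_zeroLocus hF hG, hd]

/-- By `infDist_zeroLocus`, preserving distances to the locus means preserving `F`, so the graph of
`φ` is a finite partial isometry to which back-and-forth applies. -/
theorem isUltrahomogeneousSubset_zeroLocus [CompleteSpace U] [TopologicalSpace.SeparableSpace U]
    (hF : LipschitzWith 1 F) (hG : IsGeneric F) : IsUltrahomogeneousSubset (zeroLocus F) := by
  intro A φ hA hφ hd
  simp only [infDist_zeroLocus hF hG] at hd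
  have := hA.to_subtype
  have hR : IsPartialIso F F (Set.range fun a : A => ((a : U), φ a)) := by
    refine ⟨?_, ?_⟩
    · rintro _ ⟨a, rfl⟩
      exact Subtype.ext (ContinuousMap.ext fun k => (hd a k).symm)
    · rintro _ ⟨a, rfl⟩ _ ⟨b, rfl⟩
      exact (hφ.dist_eq a b).symm
  obtain ⟨Φ, hΦ, hΦA⟩ := hR.exists_isometryEquiv hF hF hG hG (Set.finite_range _)
  refine ⟨Φ, fun a => hΦA _ ⟨a, rfl⟩, fun x k => ?_⟩
  change (F x).1 k = 0 ↔ (F (Φ x)).1 k = 0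
  rw [hΦ]

end ZeroLocus

end DistMap

theorem theorem2p3 :
    (∃ (U : Type u) (_ : MetricSpace U), IsUrysohnSpace U) ∧
    ∀ (U : Type u) [MetricSpace U], IsUrysohnSpace U →
      ∀ (K : Type v) [MetricSpace K] [CompactSpace K],
        ∃ C : Set (SumProd U K),
          IsClosed C ∧ IsUniversalClosedSubset.{u, v, w} C ∧ IsUltrahomogeneousSubset C := by
  refine ⟨exists_isUrysohnSpace, fun U _ hU K _ _ => ?_⟩
  have := hU.complete
  have := hU.separable
  obtain ⟨F, hF, hG⟩ := hU.exists_isGeneric_distMap K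
  exact ⟨zeroLocus F, isClosed_zeroLocus hF, isUniversalClosedSubset_zeroLocus hF hG,
    isUltrahomogeneousSubset_zeroLocus hF hG⟩
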